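/- Let $d\in\mathbb{N}$ and let $A\subseteq\mathbb{Z}^d$ be a finite set (a vector addition system), whose elements are called actions. For $x,y\in\mathbb{N}^d$ and a word $\sigma=a_1\cdots a_k$ of actions of $A$, write $x\xrightarrow{\sigma}y$ if there are $c_0,\dots,c_k\in\mathbb{N}^d$ with $c_0=x$, $c_k=y$ and $c_j=c_{j-1}+a_j$ for $1\le j\le k$. For an action $\mathbf{a}\in A$, let the reversibility domain $D_{\mathbf{a}}$ be the set of all $c\in\mathbb{N}^d$ such that $c\xrightarrow{\mathbf{a}}c+\mathbf{a}\xrightarrow{\alpha}c$ for some word $\alpha$ of actions of $A$. For $z\in\mathbb{Z}^d$ put $\|z\|_\infty=\max_i|z(i)|$, and put $\|A\|_\infty=\max_{z\in A}\|z\|_\infty$ (a maximum over an empty set being $0$). Then for every $\mathbf{a}\in A$ the set $D_{\mathbf{a}}$ is upward closed for the component-wise order on $\mathbb{N}^d$, and every minimal element $c$ of $D_{\mathbf{a}}$ for this order satisfies, with $a=\|A\|_\infty$, $$\|c\|_\infty\le\bigl(102\,d^2a^2\bigr)^{(15\,d^{d+2})^{d+2}}.$$ (For $d=0$ the convention $0^0=1$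 is used.) -/

import Mathlib

namespace VAS

/-- The norm `‖z‖∞ = max_i |z(i)|` of an integer vector, a natural number
(equal to `0` in dimension `0`). -/
def vecNorm {d : ℕ} (z : Fin d → ℤ) : ℕ :=
  Finset.univ.sup fun i => (z i).natAbs

/-- The norm `‖A‖∞ = max_{z ∈ A} ‖z‖∞` of a finite set of integer vectors
(equal to `0` for the empty set). -/
def setNorm {d : ℕ} (A : Finset (Fin d → ℤ)) : ℕ :=
  A.sup vecNorm

/-- A standard configuration, i.e. a vector of `ℕ^d`, seen as an integer vector. -/
def toIntVec {d : ℕ} (c : Fin d → ℕ) : Fin d → ℤ :=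
  fun i => (c i : ℤ)

/-- `Run A x σ y`: in the vector addition system `A` there is a run from the standard
configuration `x` to the standard configuration `y` labelled by the word `σ` of actions of `A`.
All intermediate configurations are vectors of `ℕ^d`, and each one is obtained from the
previous one by adding the corresponding action. -/
inductive Run {d : ℕ} (A : Finset (Fin d → ℤ)) :
    (Fin d → ℕ) → List (Fin d → ℤ) → (Fin d → ℕ) → Prop
  | nil (x : Fin d → ℕ) : Run A x [] x
  | cons {x y z : Fin d → ℕ} {a : Fin d → ℤ} {σ : List (Fin d → ℤ)}
      (ha : a ∈ A) (hstep : toIntVec y = toIntVec x + a) (hrun : Run A y σ z) :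
      Run A x (a :: σ) z

/-- The reversibility domain of the action `a`: the standard configurations `c` such that
`c + a` is a standard configuration and `c --a--> c + a --α--> c` for some word `α`
of actions of `A`. -/
def reversibilityDomain {d : ℕ} (A : Finset (Fin d → ℤ)) (a : Fin d → ℤ) :
    Set (Fin d → ℕ) :=
  {c | ∃ c' : Fin d → ℕ, toIntVec c' = toIntVec c + a ∧ Run A c [a] c' ∧
    ∃ α : List (Fin d → ℤ), Run A c' α c}

end VAS

namespace VAS

/-- Two integer vectors agree on all coordinates outside `K`. -/
def AgreeOff {d : ℕ} (K : Finset (Fin d)) (x y : Fin d → ℤ) : Prop :=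
  ∀ i ∉ K, x i = y i

/-- `x` agrees outside `K` with a configuration of `S`. -/
def InProj {d : ℕ} (S : Set (Fin d → ℤ)) (K : Finset (Fin d)) (x : Fin d → ℤ) : Prop :=
  ∃ s ∈ S, AgreeOff K s x

/-- `Walk A S K x σ`: the word `σ` labels a walk from `x` all of whose steps agree outside `K`
with steps between configurations of `S` by actions of `A`. -/
def Walk {d : ℕ} (A S : Set (Fin d → ℤ)) (K : Finset (Fin d)) :
    (Fin d → ℤ) → List (Fin d → ℤ) → Prop
  | _, [] => True
  | x, b :: σ => (b ∈ A ∧ ∃ s ∈ S, s + b ∈ S ∧ AgreeOff K s x) ∧ Walk A S K (x + b) σ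

/-- All positions `x + τ.sum`, for `τ` a prefix of `σ`, satisfy `P`. -/
def Stay {d : ℕ} (P : (Fin d → ℤ) → Prop) : (Fin d → ℤ) → List (Fin d → ℤ) → Prop
  | x, [] => P x
  | x, b :: σ => P x ∧ Stay P (x + b) σ

/-- The word that undoes `σ`. -/
def undo {d : ℕ} (σ : List (Fin d → ℤ)) : List (Fin d → ℤ) :=
  (σ.map fun b => -b).reverse

variable {d : ℕ} {A S : Set (Fin d → ℤ)} {K : Finset (Fin d)} {x y z : Fin d → ℤ}
  {σ τ : List (Fin d → ℤ)} {P Q : (Fin d → ℤ) → Prop}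

theorem AgreeOff.refl (x : Fin d → ℤ) : AgreeOff K x x := fun _ _ => rfl

theorem AgreeOff.symm (h : AgreeOff K x y) : AgreeOff K y x := fun i hi => (h i hi).symm

theorem AgreeOff.trans (h : AgreeOff K x y) (h' : AgreeOff K y z) : AgreeOff K x z :=
  fun i hi => (h i hi).trans (h' i hi)

theorem AgreeOff.add_right (h : AgreeOff K x y) (z : Fin d → ℤ) :
    AgreeOff K (x + z) (y + z) := fun i hi => by simp [h i hi]

theorem AgreeOff.mono {K' : Finset (Fin d)} (hK : K ⊆ K') (h : AgreeOff K x y) :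
    AgreeOff K' x y := fun i hi => h i fun h' => hi (hK h')

theorem InProj.congr (h : AgreeOff K x y) (hx : InProj S K x) : InProj S K y := by
  obtain ⟨s, hs, h'⟩ := hx
  exact ⟨s, hs, h'.trans h⟩

theorem InProj.of_mem (hx : x ∈ S) : InProj S K x := ⟨x, hx, AgreeOff.refl x⟩

theorem walk_append :
    Walk A S K x (σ ++ τ) ↔ Walk A S K x σ ∧ Walk A S K (x + σ.sum) τ := by
  induction σ generalizing x with
  | nil => simp [Walk]
  | cons b σ ih => simp [Walk, ih, and_assoc, add_assoc]

theorem stay_append : Stay P x (σ ++ τ) ↔ Stay P x σ ∧ Stay P (x + σ.sum) τ := by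
  induction σ generalizing x with
  | nil =>
    cases τ <;> simp [Stay]
  | cons b σ ih => simp [Stay, ih, and_assoc, add_assoc]

theorem Walk.congr (h : AgreeOff K x y) (hw : Walk A S K x σ) : Walk A S K y σ := by
  induction σ generalizing x y with
  | nil => trivial
  | cons b σ ih =>
    obtain ⟨⟨hb, s, hs, hs', h'⟩, hw⟩ := hw
    exact ⟨⟨hb, s, hs, hs', h'.trans h⟩, ih (h.add_right b) hw⟩

theorem Walk.mono {K' : Finset (Fin d)} (hK : K ⊆ K') (hw : Walk A S K x σ) :
    Walk A S K' x σ := by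
  induction σ generalizing x with
  | nil => trivial
  | cons b σ ih =>
    obtain ⟨⟨hb, s, hs, hs', h'⟩, hw⟩ := hw
    exact ⟨⟨hb, s, hs, hs', h'.mono hK⟩, ih hw⟩

theorem Walk.mem (hw : Walk A S K x σ) : ∀ b ∈ σ, b ∈ A := by
  induction σ generalizing x with
  | nil => simp
  | cons b σ ih =>
    intro c hc
    rcases List.mem_cons.1 hc with rfl | hc
    · exact hw.1.1
    · exact ih hw.2 c hc

theorem Walk.inProj (hx : InProj S K x) (hw : Walk A S K x σ) : InProj S K (x + σ.sum) := by
  induction σ generalizing x with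
  | nil => simpa using hx
  | cons b σ ih =>
    obtain ⟨⟨_, s, _, hs', h'⟩, hw⟩ := hw
    simpa [add_assoc] using ih ⟨s + b, hs', h'.add_right b⟩ hw

theorem Walk.stay_inProj (hx : InProj S K x) (hw : Walk A S K x σ) :
    Stay (InProj S K) x σ := by
  induction σ generalizing x with
  | nil => exact hx
  | cons b σ ih =>
    obtain ⟨⟨_, s, _, hs', h'⟩, hw⟩ := hw
    exact ⟨hx, ih ⟨s + b, hs', h'.add_right b⟩ hw⟩

theorem Stay.mono (hPQ : ∀ y, P y → Q y) (h : Stay P x σ) : Stay Q x σ := by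
  induction σ generalizing x with
  | nil => exact hPQ _ h
  | cons b σ ih => exact ⟨hPQ _ h.1, ih h.2⟩

theorem Stay.and (h : Stay P x σ) (h' : Stay Q x σ) : Stay (fun y => P y ∧ Q y) x σ := by
  induction σ generalizing x with
  | nil => exact ⟨h, h'⟩
  | cons b σ ih => exact ⟨⟨h.1, h'.1⟩, ih h.2 h'.2⟩

theorem Stay.head (h : Stay P x σ) : P x := by
  cases σ with
  | nil => exact h
  | cons b σ => exact h.1

theorem Stay.last (h : Stay P x σ) : P (x + σ.sum) := by
  induction σ generalizing x with
  | nil => simpa using h.head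
  | cons b σ ih => simpa [add_assoc] using ih h.2

theorem Stay.take (h : Stay P x σ) (n : ℕ) : P (x + (σ.take n).sum) := by
  rw [← List.take_append_drop n σ, stay_append] at h
  exact h.1.last

theorem Stay.shift (v : Fin d → ℤ) (h : Stay P x σ) :
    Stay (fun y => P (y - v)) (x + v) σ := by
  induction σ generalizing x with
  | nil => simpa [Stay] using h
  | cons b σ ih =>
    refine ⟨by simpa using h.1, ?_⟩
    have := ih h.2
    rwa [add_right_comm] at this

/-- A word with letters bounded by `a` moves each coordinate by at most `a` times its length. -/
theorem stay_abs_sub_le {a : ℕ} (hσ : ∀ b ∈ σ, ∀ i, |b i| ≤ (a : ℤ)) (x : Fin d → ℤ) :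
    Stay (fun y => ∀ i, |y i - x i| ≤ (a : ℤ) * σ.length) x σ := by
  induction σ generalizing x with
  | nil => simp [Stay]
  | cons b σ ih =>
    refine ⟨fun i => by simp, ?_⟩
    refine (ih (fun c hc => hσ c (by simp [hc])) (x + b)).mono fun y hy i => ?_
    have h1 := hy i
    have h2 := hσ b (by simp) i
    have h3 : |y i - x i| ≤ |y i - (x + b) i| + |b i| := by
      have := abs_add_le (y i - (x + b) i) (b i)
      rwa [Pi.add_apply, show y i - (x i + b i) + b i = y i - x i by ring] at this
    push_cast [List.length_cons]
    linarith

theorem abs_sum_le {a : ℕ} (hσ : ∀ b ∈ σ, ∀ i, |b i| ≤ (a : ℤ)) (i : Fin d) :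
    |σ.sum i| ≤ (a : ℤ) * σ.length := by
  simpa using (stay_abs_sub_le hσ 0).last i

theorem undo_sum (σ : List (Fin d → ℤ)) : (undo σ).sum = -σ.sum := by
  induction σ with
  | nil => simp [undo]
  | cons b σ ih =>
    have : undo (b :: σ) = undo σ ++ [-b] := by simp [undo]
    simp [this, ih]

theorem undo_length (σ : List (Fin d → ℤ)) : (undo σ).length = σ.length := by simp [undo]

theorem stay_undo (h : Stay P x σ) : Stay P (x + σ.sum) (undo σ) := by
  induction σ generalizing x with
  | nil => simpa [undo] using h
  | cons b σ ih =>
    have : undo (b :: σ) = undo σ ++ [-b] := by simp [undo]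
    rw [this, stay_append, undo_sum]
    have h2 := ih h.2
    have h3 := h.2.head
    have e : x + (b :: σ).sum = x + b + σ.sum := by simp [add_assoc]
    rw [e]
    refine ⟨h2, ?_, ?_⟩
    · simpa using h3
    · simpa [Stay] using h.1

theorem walk_undo (h : Walk (Neg.neg ⁻¹' A) S K x σ) : Walk A S K (x + σ.sum) (undo σ) := by
  induction σ generalizing x with
  | nil => trivial
  | cons b σ ih =>
    have : undo (b :: σ) = undo σ ++ [-b] := by simp [undo]
    rw [this, walk_append, undo_sum]
    have e : x + (b :: σ).sum = x + b + σ.sum := by simp [add_assoc]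
    rw [e]
    obtain ⟨⟨hb, s, hs, hs', h'⟩, hw⟩ := h
    refine ⟨ih hw, ⟨hb, s + b, hs', by simpa using hs, ?_⟩, trivial⟩
    simpa using h'.add_right b

/-- Any two configurations of `S` are joined by a walk inside `S`. -/
def Connected {d : ℕ} (A S : Set (Fin d → ℤ)) : Prop :=
  ∀ s ∈ S, ∀ s' ∈ S, ∃ σ, Walk A S ∅ s σ ∧ s + σ.sum = s'

theorem Connected.neg (h : Connected A S) : Connected (Neg.neg ⁻¹' A) S := by
  intro s hs s' hs'
  obtain ⟨σ, hσ, hsum⟩ := h s' hs' s hs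
  have : Neg.neg ⁻¹' (Neg.neg ⁻¹' A) = A := by ext; simp
  rw [← this] at hσ
  refine ⟨undo σ, hsum ▸ walk_undo hσ, ?_⟩
  rw [undo_sum, ← hsum]
  simp

theorem Connected.exists_walk (h : Connected A S) (hx : InProj S K x) (hy : InProj S K y) :
    ∃ σ, Walk A S K x σ ∧ AgreeOff K (x + σ.sum) y := by
  obtain ⟨s, hs, hsx⟩ := hx
  obtain ⟨s', hs', hsy⟩ := hy
  obtain ⟨σ, hσ, hsum⟩ := h s hs s' hs'
  refine ⟨σ, (hσ.mono (Finset.empty_subset K)).congr hsx, ?_⟩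
  exact ((hsx.symm.add_right _).trans (by rw [hsum]; exact AgreeOff.refl _)).trans hsy

theorem Connected.exists_reverse_walk (h : Connected A S) (hw : Walk A S K x σ) :
    ∃ τ, Walk A S K (x + σ.sum) τ ∧ τ.sum = -σ.sum := by
  induction σ generalizing x with
  | nil => exact ⟨[], trivial, by simp⟩
  | cons b σ ih =>
    obtain ⟨⟨hb, s, hs, hs', h'⟩, hw⟩ := hw
    obtain ⟨τ, hτ, hsum⟩ := ih hw
    obtain ⟨ρ, hρ, hρs⟩ := h _ hs' _ hs
    have e : x + (b :: σ).sum = x + b + σ.sum := by simp [add_assoc]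
    rw [e]
    refine ⟨τ ++ ρ, walk_append.2 ⟨hτ, ?_⟩, ?_⟩
    · rw [hsum]
      refine (hρ.mono (Finset.empty_subset K)).congr ?_
      simpa using h'.add_right b
    · have : ρ.sum = -b := by
        rw [add_assoc] at hρs
        have := add_eq_left.1 hρs
        exact eq_neg_of_add_eq_zero_right this
      simp [hsum, this]

/-- Among the first `s.card + 1` prefix sums of a word, two have the same image in `s`. -/
theorem exists_infix_of_card_le {α : Type*} [DecidableEq α] (s : Finset α)
    (g : (Fin d → ℤ) → α) (hg : ∀ n ≤ s.card, g (σ.take n).sum ∈ s) (hs : s.card ≤ σ.length) :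
    ∃ σ₁ σ₂ σ₃, σ = σ₁ ++ σ₂ ++ σ₃ ∧ σ₂ ≠ [] ∧ (σ₁ ++ σ₂).length ≤ s.card ∧
      g σ₁.sum = g (σ₁ ++ σ₂).sum := by
  obtain ⟨m, hm, n, hn, hmn, he⟩ := Finset.exists_ne_map_eq_of_card_lt_of_maps_to
    (s := Finset.range (s.card + 1)) (t := s) (by simp) (f := fun n => g (σ.take n).sum)
    (fun n hn => hg n (by simpa [Nat.lt_succ_iff] using hn))
  wlog h : m < n generalizing m n
  · exact this n hn m hm hmn.symm he.symm (by omega)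
  have hn' : n ≤ s.card := by simpa [Nat.lt_succ_iff] using hn
  have e : σ.take m ++ (σ.take n).drop m = σ.take n := by
    have := List.take_append_drop m (σ.take n)
    rwa [List.take_take, min_eq_left h.le] at this
  refine ⟨σ.take m, (σ.take n).drop m, σ.drop n, ?_, ?_, ?_, ?_⟩
  · rw [e, List.take_append_drop]
  · intro h0
    have := congrArg List.length h0
    simp at this
    omega
  · rw [e, List.length_take]
    omega
  · rw [e]
    exact he

end VAS

namespace VAS

variable {d : ℕ}

theorem neg_le_of_scaled {n j y δ C : ℤ} (hn : 0 < n) (hj : 0 ≤ j) (hjn : j ≤ n)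
    (h : |n * y - j * δ| ≤ n * C) : min 0 δ - C ≤ y ∧ y ≤ max 0 δ + C := by
  obtain ⟨h1, h2⟩ := abs_le.1 h
  constructor
  · have : n * min 0 δ ≤ j * δ := by
      rcases le_total 0 δ with h0 | h0
      · rw [min_eq_left h0]; simp; positivity
      · rw [min_eq_right h0]; nlinarith
    have : n * (min 0 δ - C) ≤ n * y := by linarith
    exact le_of_mul_le_mul_left this hn
  · have : j * δ ≤ n * max 0 δ := by
      rcases le_total 0 δ with h0 | h0
      · rw [max_eq_right h0]; nlinarith
      · rw [max_eq_left h0]; simp; nlinarith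
    have : n * y ≤ n * (max 0 δ + C) := by linarith
    exact le_of_mul_le_mul_left this hn

/-- A list of vectors can be permuted so that its prefix sums follow the segment from `0` to its
sum, up to an error that depends only on the number and the size of the distinct vectors. -/
theorem exists_perm_stay (l : List (Fin d → ℤ)) {β N : ℕ}
    (hβ : ∀ b ∈ l, ∀ i, |b i| ≤ (β : ℤ)) (hN : l.toFinset.card ≤ N) :
    ∃ l' : List (Fin d → ℤ), l'.Perm l ∧ Stay (fun y => ∀ i,
      min 0 (l.sum i) - (2 * N * β : ℕ) ≤ y i ∧ y i ≤ max 0 (l.sum i) + (2 * N * β : ℕ)) 0 l' := by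
  classical
  set n := l.length with hn
  rcases Nat.eq_zero_or_pos n with h0 | hpos
  · have : l = [] := List.length_eq_zero_iff.1 h0
    subst this
    exact ⟨[], List.Perm.refl _, fun i => by simp; positivity⟩
  let q : ℕ → (Fin d → ℤ) → ℕ := fun j b => j * l.count b / n
  let M : ℕ → Multiset (Fin d → ℤ) := fun j =>
    ∑ b ∈ l.toFinset, Multiset.replicate (q j b) b
  have hcount : ∀ b, l.count b ≤ n := fun b => List.count_le_length
  have hq : ∀ j b, q j b ≤ q (j + 1) b ∧ q (j + 1) b ≤ q j b + 1 := by
    intro j b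
    constructor
    · exact Nat.div_le_div_right (by nlinarith)
    · calc (j + 1) * l.count b / n ≤ (j * l.count b + n) / n :=
            Nat.div_le_div_right (by nlinarith [hcount b])
        _ = _ := by rw [Nat.add_div_right _ hpos]
  have hMle : ∀ j, M j ≤ M (j + 1) := fun j =>
    Finset.sum_le_sum fun b _ => (Multiset.replicate_le_replicate b).2 (hq j b).1
  have hMcard : ∀ j, (M (j + 1)).card ≤ (M j).card + N := by
    intro j
    simp only [M, Multiset.card_sum, Multiset.card_replicate]
    calc ∑ b ∈ l.toFinset, q (j + 1) b ≤ ∑ b ∈ l.toFinset, (q j b + 1) :=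
          Finset.sum_le_sum fun b _ => (hq j b).2
      _ ≤ _ := by rw [Finset.sum_add_distrib]; simpa using hN
  have hMmem : ∀ j, ∀ b ∈ M j, b ∈ l := by
    intro j b hb
    simp only [M, Multiset.mem_sum] at hb
    obtain ⟨c, hc, hbc⟩ := hb
    rw [Multiset.eq_of_mem_replicate hbc]
    simpa using hc
  have hsum : l.sum = ∑ b ∈ l.toFinset, l.count b • b := Finset.sum_list_count l
  have hMsum : ∀ j, j ≤ n → ∀ i, min 0 (l.sum i) - (N * β : ℕ) ≤ (M j).sum i ∧
      (M j).sum i ≤ max 0 (l.sum i) + (N * β : ℕ) := by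
    intro j hj i
    have e : (M j).sum i = ∑ b ∈ l.toFinset, (q j b : ℤ) * b i := by
      simp [M, Multiset.sum_sum, Finset.sum_apply]
    have e' : l.sum i = ∑ b ∈ l.toFinset, (l.count b : ℤ) * b i := by
      rw [hsum]; simp [Finset.sum_apply]
    refine neg_le_of_scaled (n := n) (j := j) (by exact_mod_cast hpos) (by positivity)
      (by exact_mod_cast hj) ?_
    rw [e, e', Finset.mul_sum, Finset.mul_sum, ← Finset.sum_sub_distrib]
    refine (Finset.abs_sum_le_sum_abs _ _).trans ?_
    calc _ ≤ ∑ b ∈ l.toFinset, (n * β : ℤ) := by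
          refine Finset.sum_le_sum fun b hb => ?_
          have h1 : (n : ℤ) * (q j b * b i) - j * (l.count b * b i) =
              ((n * q j b : ℕ) - (j * l.count b : ℕ) : ℤ) * b i := by push_cast; ring
          rw [h1, abs_mul]
          refine mul_le_mul ?_ (hβ b (by simpa using hb) i) (abs_nonneg _) (by positivity)
          have h2 := Nat.div_add_mod (j * l.count b) n
          have h3 := Nat.mod_lt (j * l.count b) hpos
          rw [abs_le]
          simp only [q]
          omega
      _ = n * (l.toFinset.card * β) := by simp; ring
      _ ≤ _ := by
          push_cast
          gcongr
  have key : ∀ j, j ≤ n → ∃ l' : List (Fin d → ℤ), (l' : Multiset (Fin d → ℤ)) = M j ∧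
      Stay (fun y => ∀ i, min 0 (l.sum i) - (2 * N * β : ℕ) ≤ y i ∧
        y i ≤ max 0 (l.sum i) + (2 * N * β : ℕ)) 0 l' := by
    intro j
    induction j with
    | zero =>
      intro _
      refine ⟨[], by simp [M, q], fun i => ?_⟩
      have : (0 : ℤ) ≤ (2 * N * β : ℕ) := by positivity
      constructor
      · have := min_le_left 0 (l.sum i); simp only [Pi.zero_apply]; linarith
      · have := le_max_left 0 (l.sum i); simp only [Pi.zero_apply]; linarith
    | succ j ih =>
      intro hj
      obtain ⟨l', hl', hst⟩ := ih (by omega)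
      have hD : M j + (M (j + 1) - M j) = M (j + 1) := add_tsub_cancel_of_le (hMle j)
      refine ⟨l' ++ (M (j + 1) - M j).toList, ?_, stay_append.2 ⟨hst, ?_⟩⟩
      · rw [← Multiset.coe_add, hl', Multiset.coe_toList, hD]
      · have hlen : (M (j + 1) - M j).toList.length ≤ N := by
          rw [Multiset.length_toList, Multiset.card_sub (hMle j)]
          have := hMcard j
          omega
        have hs : l'.sum = (M j).sum := by rw [← hl', Multiset.sum_coe]
        refine (stay_abs_sub_le (a := β) (fun b hb => hβ b (hMmem (j + 1) b ?_)) _).mono ?_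
        · exact Multiset.mem_of_le tsub_le_self (Multiset.mem_toList.1 hb)
        · intro y hy i
          have h1 := hMsum j (by omega) i
          have h2 := abs_le.1 (hy i)
          have h3 : (β : ℤ) * ((M (j + 1) - M j).toList.length) ≤ (N * β : ℕ) := by
            push_cast
            rw [mul_comm]
            gcongr
          simp only [zero_add, hs] at h2
          push_cast at h1 h3 ⊢
          constructor <;> linarith
  obtain ⟨l', hl', hst⟩ := key n le_rfl
  refine ⟨l', ?_, hst⟩
  rw [← Multiset.coe_eq_coe, hl']
  simp only [M, q]
  rw [← Multiset.toFinset_sum_count_nsmul_eq (l : Multiset (Fin d → ℤ))]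
  refine Finset.sum_congr (by simp) fun b _ => ?_
  rw [Nat.mul_div_cancel_left _ hpos, Multiset.nsmul_singleton]
  simp

end VAS

namespace VAS

variable {d : ℕ} {A S : Set (Fin d → ℤ)} {K : Finset (Fin d)} {x y z : Fin d → ℤ}
  {σ τ : List (Fin d → ℤ)} {P Q : (Fin d → ℤ) → Prop}

theorem Walk.append_closed (h : Walk A S K x σ) (hσ : AgreeOff K σ.sum 0)
    (h' : Walk A S K x τ) : Walk A S K x (σ ++ τ) := by
  refine walk_append.2 ⟨h, h'.congr fun i hi => ?_⟩
  simp [hσ i hi]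

/-- A closed infix of a walk can be cut out. -/
theorem Walk.cut {ρ : List (Fin d → ℤ)} (h : Walk A S K x (σ ++ τ ++ ρ))
    (hτ : AgreeOff K τ.sum 0) : Walk A S K x (σ ++ ρ) := by
  obtain ⟨h1, h2⟩ := walk_append.1 h
  refine walk_append.2 ⟨(walk_append.1 h1).1, h2.congr fun i hi => ?_⟩
  simp [hτ i hi]

/-- A walk with at least `B ^ d` steps whose first positions are below `B` contains
a short closed infix. -/
theorem Walk.exists_closed_infix {B : ℕ} (hB : 0 < B) (hS : ∀ s ∈ S, ∀ i, 0 ≤ s i)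
    (hx : InProj S K x) (hw : Walk A S K x σ)
    (hlt : ∀ n ≤ B ^ d, ∀ i ∉ K, (x + (σ.take n).sum) i < B) (hlen : B ^ d ≤ σ.length) :
    ∃ σ₁ σ₂ σ₃, σ = σ₁ ++ σ₂ ++ σ₃ ∧ σ₂ ≠ [] ∧ (σ₁ ++ σ₂).length ≤ B ^ d ∧
      AgreeOff K σ₂.sum 0 := by
  classical
  let s : Finset (Fin d → ℤ) := Fintype.piFinset fun _ => Finset.Ico (0 : ℤ) B
  have hs : s.card = B ^ d := by simp [s]
  let g : (Fin d → ℤ) → Fin d → ℤ := fun v i => if i ∈ K then 0 else x i + v i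
  obtain ⟨σ₁, σ₂, σ₃, h1, h2, h3, h4⟩ := exists_infix_of_card_le (σ := σ) s g
    (fun n hn => by
      refine Fintype.mem_piFinset.2 fun i => Finset.mem_Ico.2 ?_
      simp only [g]
      split_ifs with hi
      · exact ⟨le_rfl, by exact_mod_cast hB⟩
      · obtain ⟨t, ht, hti⟩ := (hw.stay_inProj hx).take n
        refine ⟨?_, hlt n (hs ▸ hn) i hi⟩
        have := hS t ht i
        rw [hti i hi] at this
        exact this) (hs ▸ hlen)
  refine ⟨σ₁, σ₂, σ₃, h1, h2, hs ▸ h3, fun i hi => ?_⟩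
  have := congrFun h4 i
  simpa [g, hi] using this

/-- If all vertices outside a set are below `B`, then the set, when reachable, is reachable
in at most `B ^ d` steps. -/
theorem exists_short_walk {B : ℕ} (hB : 0 < B) (hS : ∀ s ∈ S, ∀ i, 0 ≤ s i)
    (hP : ∀ y z, AgreeOff K y z → P y → P z)
    (hPB : ∀ y, InProj S K y → ¬ P y → ∀ i ∉ K, y i < B)
    (hx : InProj S K x) (hex : ∃ σ, Walk A S K x σ ∧ P (x + σ.sum)) :
    ∃ σ, Walk A S K x σ ∧ P (x + σ.sum) ∧ σ.length ≤ B ^ d := by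
  classical
  have hex' : ∃ n, ∃ σ, Walk A S K x σ ∧ P (x + σ.sum) ∧ σ.length = n := by
    obtain ⟨σ, h1, h2⟩ := hex
    exact ⟨_, σ, h1, h2, rfl⟩
  obtain ⟨σ, h1, h2, h3⟩ := Nat.find_spec hex'
  refine ⟨σ, h1, h2, ?_⟩
  by_contra! hlen
  have hmin : ∀ τ, Walk A S K x τ → P (x + τ.sum) → σ.length ≤ τ.length := fun τ ht ht' =>
    h3 ▸ Nat.find_min' hex' ⟨τ, ht, ht', rfl⟩
  obtain ⟨σ₁, σ₂, σ₃, h4, h5, -, h7⟩ := h1.exists_closed_infix hB hS hx (fun n hn => by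
    have hw : Walk A S K x (σ.take n) := by
      rw [← List.take_append_drop n σ, walk_append] at h1
      exact h1.1
    refine hPB _ (hw.inProj hx) fun hp => ?_
    have := hmin _ hw hp
    rw [List.length_take] at this
    omega) hlen.le
  subst h4
  have := hmin (σ₁ ++ σ₃) (h1.cut h7) (hP _ _ (fun i hi => by simp [h7 i hi]) h2)
  have h8 := List.length_pos_iff.2 h5
  simp only [List.length_append] at this
  omega

/-- The displacements of the closed walks of length at most `L`. -/
def cycleSums {d : ℕ} (A S : Set (Fin d → ℤ)) (K : Finset (Fin d)) (L : ℕ) :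
    Set (Fin d → ℤ) :=
  {v | AgreeOff K v 0 ∧ ∃ y θ, InProj S K y ∧ Walk A S K y θ ∧ θ.sum = v ∧ θ.length ≤ L}

theorem cycleSums_abs_le {a L : ℕ} (hA : ∀ b ∈ A, ∀ i, |b i| ≤ (a : ℤ)) {v : Fin d → ℤ}
    (hv : v ∈ cycleSums A S K L) (i : Fin d) : |v i| ≤ (a * L : ℕ) := by
  obtain ⟨-, y, θ, -, hw, rfl, hl⟩ := hv
  refine (abs_sum_le (fun b hb => hA b (hw.mem b hb)) i).trans ?_
  push_cast
  gcongr

/-- The displacement of a closed walk is a sum of displacements of short closed walks. -/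
theorem exists_list_cycleSums {B L : ℕ} (hB : 0 < B) (hS : ∀ s ∈ S, ∀ i, 0 ≤ s i)
    (hSB : ∀ y, InProj S K y → ∀ i ∉ K, y i < B) (hL : B ^ d ≤ L)
    (hx : InProj S K x) (hw : Walk A S K x σ) (hσ : AgreeOff K σ.sum 0) :
    ∃ l : List (Fin d → ℤ), (∀ v ∈ l, v ∈ cycleSums A S K L) ∧ l.sum = σ.sum := by
  induction hn : σ.length using Nat.strong_induction_on generalizing σ with
  | _ n ih =>
    rcases le_or_gt σ.length (B ^ d) with hle | hgt
    · refine ⟨[σ.sum], ?_, by simp⟩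
      simp only [List.mem_singleton, forall_eq]
      exact ⟨hσ, x, σ, hx, hw, rfl, hle.trans hL⟩
    · obtain ⟨σ₁, σ₂, σ₃, h1, h2, h3, h4⟩ := hw.exists_closed_infix hB hS hx
        (fun n _ => hSB _ ((hw.stay_inProj hx).take n)) hgt.le
      subst h1
      have h5 := List.length_pos_iff.2 h2
      obtain ⟨l, hl, hls⟩ := ih (σ₁ ++ σ₃).length (by simp at hn ⊢; omega) (hw.cut h4)
        (fun i hi => by
          have h6 := h4 i hi
          have h7 := hσ i hi
          simp at h6 h7 ⊢
          linarith) rfl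
      obtain ⟨h8, h9⟩ := walk_append.1 (walk_append.1 hw).1
      refine ⟨σ₂.sum :: l, ?_, ?_⟩
      · simp only [List.mem_cons, forall_eq_or_imp]
        refine ⟨⟨h4, x + σ₁.sum, σ₂, h8.inProj hx, h9, rfl, ?_⟩, hl⟩
        simp at h3
        omega
      · simp [hls]
        abel

/-- The walk `σ` from `x` goes through the vertex `y`. -/
def Visits {d : ℕ} (K : Finset (Fin d)) (x : Fin d → ℤ) (σ : List (Fin d → ℤ))
    (y : Fin d → ℤ) : Prop :=
  ∃ σ₁ σ₂, σ = σ₁ ++ σ₂ ∧ AgreeOff K (x + σ₁.sum) y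

theorem Visits.insert {θ : List (Fin d → ℤ)} (hθ : AgreeOff K θ.sum 0)
    (h : Visits K x (σ ++ τ) y) : Visits K x (σ ++ θ ++ τ) y := by
  obtain ⟨ρ₁, ρ₂, h1, h2⟩ := h
  rcases List.append_eq_append_iff.1 h1 with ⟨as, rfl, rfl⟩ | ⟨bs, rfl, rfl⟩
  · refine ⟨σ ++ θ ++ as, ρ₂, by simp, fun i hi => ?_⟩
    have h3 := h2 i hi
    have h4 := hθ i hi
    simp at h3 h4 ⊢
    linarith
  · exact ⟨ρ₁, bs ++ θ ++ τ, by simp, h2⟩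

theorem exists_tour {B : ℕ} (hB : 0 < B) (hS : ∀ s ∈ S, ∀ i, 0 ≤ s i) (hc : Connected A S)
    (hSB : ∀ y, InProj S K y → ∀ i ∉ K, y i < B) (hx : InProj S K x)
    (F : Finset (Fin d → ℤ)) (hF : ∀ y ∈ F, InProj S K y) :
    ∃ T, Walk A S K x T ∧ AgreeOff K T.sum 0 ∧ T.length ≤ 2 * B ^ d * F.card ∧
      ∀ y ∈ F, Visits K x T y := by
  classical
  induction F using Finset.induction_on with
  | empty => exact ⟨[], trivial, AgreeOff.refl _, by simp, by simp⟩
  | insert y F hy ih =>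
    obtain ⟨T, h1, h2, h3, h4⟩ := ih fun z hz => hF z (by simp [hz])
    have hyP := hF y (by simp)
    have short : ∀ x y, InProj S K x → InProj S K y →
        ∃ σ, Walk A S K x σ ∧ AgreeOff K (x + σ.sum) y ∧ σ.length ≤ B ^ d := fun x y hx hy =>
      exists_short_walk (P := fun z => AgreeOff K z y) hB hS
        (fun z w hzw hz => hzw.symm.trans hz) (fun z hz _ => hSB z hz) hx (hc.exists_walk hx hy)
    obtain ⟨p, hp, hpy, hpl⟩ := short x y hx hyP
    obtain ⟨r, hr, hrx, hrl⟩ := short (x + p.sum) x (hp.inProj hx) hx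
    have hpr : AgreeOff K (p ++ r).sum 0 := fun i hi => by
      have := hrx i hi
      simp at this ⊢
      linarith
    have hprw : Walk A S K x (p ++ r) := walk_append.2 ⟨hp, hr⟩
    refine ⟨p ++ r ++ T, hprw.append_closed hpr h1, fun i hi => ?_, ?_, fun z hz => ?_⟩
    · have h5 := hpr i hi
      have h6 := h2 i hi
      rw [List.sum_append, Pi.add_apply, h5, h6]
      simp
    · rw [Finset.card_insert_of_notMem hy]
      simp only [List.length_append]
      nlinarith
    · rcases Finset.mem_insert.1 hz with rfl | hz
      · exact ⟨p, r ++ T, by simp, hpy⟩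
      · simpa using (show Visits K x ([] ++ T) z from h4 z hz).insert hpr

/-- Short closed walks can be inserted in a closed walk that visits all vertices. -/
theorem exists_insert {L : ℕ} {T : List (Fin d → ℤ)} (hT : Walk A S K x T)
    (hvis : ∀ y, InProj S K y → Visits K x T y) (l : List (Fin d → ℤ))
    (hl : ∀ v ∈ l, v ∈ cycleSums A S K L) :
    ∃ T', Walk A S K x T' ∧ T'.sum = T.sum + l.sum ∧ T'.length ≤ T.length + l.length * L ∧
      ∀ y, InProj S K y → Visits K x T' y := by
  induction l with
  | nil => exact ⟨T, hT, by simp, by simp, hvis⟩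
  | cons v l ih =>
    obtain ⟨T', h1, h2, h3, h4⟩ := ih fun w hw => hl w (by simp [hw])
    obtain ⟨hv0, y, θ, hy, hw, rfl, hlen⟩ := hl v (by simp)
    obtain ⟨T₁, T₂, rfl, h5⟩ := h4 y hy
    obtain ⟨h6, h7⟩ := walk_append.1 h1
    refine ⟨T₁ ++ θ ++ T₂, ?_, ?_, ?_, fun z hz => (h4 z hz).insert hv0⟩
    · refine walk_append.2 ⟨walk_append.2 ⟨h6, hw.congr h5.symm⟩, h7.congr fun i hi => ?_⟩
      have := hv0 i hi
      simp at this ⊢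
      exact this
    · have : T₁.sum + T₂.sum = (T₁ ++ T₂).sum := by simp
      simp only [List.sum_append, List.sum_cons] at h2 ⊢
      rw [add_left_comm, ← h2]
      abel
    · simp only [List.length_append, List.length_cons] at h3 ⊢
      nlinarith

theorem card_toFinset_le {β : ℕ} {l : List (Fin d → ℤ)}
    (hl : ∀ b ∈ l, ∀ i, |b i| ≤ (β : ℤ)) : l.toFinset.card ≤ (2 * β + 1) ^ d := by
  classical
  have hsub : l.toFinset ⊆ Fintype.piFinset fun _ : Fin d => Finset.Icc (-(β : ℤ)) β := by
    intro b hb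
    refine Fintype.mem_piFinset.2 fun i => Finset.mem_Icc.2 (abs_le.1 (hl b (by simpa using hb) i))
  refine (Finset.card_le_card hsub).trans ?_
  simp only [Fintype.card_piFinset_const, Int.card_Icc]
  refine le_of_eq ?_
  congr 1
  omega

/-- A zero-sum list of bounded vectors containing `v` can be replaced with a short one. -/
theorem exists_short_zero_sum {β : ℕ} {V : Set (Fin d → ℤ)} {v : Fin d → ℤ}
    (hV : ∀ b ∈ V, ∀ i, |b i| ≤ (β : ℤ))
    (hex : ∃ l : List (Fin d → ℤ), (∀ b ∈ l, b ∈ V) ∧ v ∈ l ∧ l.sum = 0) :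
    ∃ l : List (Fin d → ℤ), (∀ b ∈ l, b ∈ V) ∧ v ∈ l ∧ l.sum = 0 ∧
      l.length ≤ (2 * (2 * (2 * β + 1) ^ d * β) + 1) ^ d := by
  classical
  have hex' : ∃ n, ∃ l : List (Fin d → ℤ), ((∀ b ∈ l, b ∈ V) ∧ v ∈ l ∧ l.sum = 0) ∧
      l.length = n := by
    obtain ⟨l, hl⟩ := hex
    exact ⟨_, l, hl, rfl⟩
  obtain ⟨l₀, ⟨h1, h2, h3⟩, h4⟩ := Nat.find_spec hex'
  have hmin : ∀ l : List (Fin d → ℤ), (∀ b ∈ l, b ∈ V) → v ∈ l → l.sum = 0 →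
      l₀.length ≤ l.length := fun l hl hv hs => h4 ▸ Nat.find_min' hex' ⟨l, ⟨hl, hv, hs⟩, rfl⟩
  refine ⟨l₀, h1, h2, h3, ?_⟩
  by_contra! hlen
  set C := 2 * (2 * β + 1) ^ d * β with hC
  have hβ : ∀ b ∈ l₀, ∀ i, |b i| ≤ (β : ℤ) := fun b hb => hV b (h1 b hb)
  obtain ⟨l, hp, hst⟩ := exists_perm_stay l₀ hβ (card_toFinset_le hβ)
  rw [h3, ← hC] at hst
  let s : Finset (Fin d → ℤ) := Fintype.piFinset fun _ => Finset.Icc (-(C : ℤ)) C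
  have hs : s.card = (2 * C + 1) ^ d := by
    simp only [s, Fintype.card_piFinset_const, Int.card_Icc]
    congr 1
    omega
  obtain ⟨σ₁, σ₂, σ₃, e, h5, h6, h7⟩ := exists_infix_of_card_le (σ := l) s id
    (fun n _ => by
      refine Fintype.mem_piFinset.2 fun i => Finset.mem_Icc.2 ?_
      simpa using hst.take n i) (by rw [hs, hp.length_eq]; exact hlen.le)
  have h8 : σ₂.sum = 0 := by simpa using h7
  have hsum : l.sum = 0 := hp.sum_eq.trans h3
  have hV' : ∀ b ∈ l, b ∈ V := fun b hb => h1 b (hp.mem_iff.1 hb)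
  have hl : l.length = l₀.length := hp.length_eq
  have h9 := List.length_pos_iff.2 h5
  have hv : v ∈ σ₂ ∨ v ∈ σ₁ ++ σ₃ := by
    have : v ∈ l := hp.mem_iff.2 h2
    rw [e] at this
    simp only [List.mem_append] at this ⊢
    tauto
  subst e
  simp only [List.length_append] at hl h6
  rcases hv with hv | hv
  · have := hmin σ₂ (fun b hb => hV' b (by simp [hb])) hv h8
    omega
  · have := hmin (σ₁ ++ σ₃) (fun b hb => hV' b (by
      simp only [List.mem_append] at hb ⊢
      tauto)) hv (by simpa [h8] using hsum)
    simp only [List.length_append] at this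
    omega

/-- A bound for the closed walks that visit all the vertices of a graph with `B ^ d` vertices. -/
def cycleLen (d B : ℕ) : ℕ := 2 * (B ^ d) ^ 2

/-- The deviation of interleaved sums of vectors of size `β`. -/
def deviation (d β : ℕ) : ℕ := 2 * (2 * β + 1) ^ d * β

theorem pow_le_cycleLen {B : ℕ} (hB : 0 < B) : B ^ d ≤ cycleLen d B := by
  have : 0 < B ^ d := by positivity
  unfold cycleLen
  nlinarith

/-- There is a short zero-sum closed walk visiting all vertices. -/
theorem exists_zero_tour {a B : ℕ} (hB : 0 < B) (hA : ∀ b ∈ A, ∀ i, |b i| ≤ (a : ℤ))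
    (hS : ∀ s ∈ S, ∀ i, 0 ≤ s i) (hc : Connected A S)
    (hSB : ∀ y, InProj S K y → ∀ i ∉ K, y i < B) (hx : InProj S K x) :
    ∃ T, Walk A S K x T ∧ T.sum = 0 ∧
      T.length ≤ cycleLen d B * (2 * deviation d (a * cycleLen d B) + 1) ^ d ∧
      ∀ y, InProj S K y → Visits K x T y := by
  classical
  set L := cycleLen d B with hL
  obtain ⟨T, h1, h2, h3, h4⟩ := exists_tour hB hS hc hSB hx
    ((Fintype.piFinset fun _ => Finset.Ico (0 : ℤ) B).filter (InProj S K)) (by simp)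
  have h3' : T.length ≤ L := by
    refine h3.trans ?_
    have : ((Fintype.piFinset fun _ : Fin d => Finset.Ico (0 : ℤ) B).filter
      (InProj S K)).card ≤ B ^ d := (Finset.card_filter_le _ _).trans (by simp)
    calc _ ≤ 2 * B ^ d * B ^ d := by gcongr
      _ = L := by rw [hL, cycleLen]; ring
  have hvis : ∀ y, InProj S K y → Visits K x T y := by
    intro y hy
    let y' : Fin d → ℤ := fun i => if i ∈ K then 0 else y i
    have hyy : AgreeOff K y y' := fun i hi => by simp [y', hi]
    obtain ⟨T₁, T₂, e, h5⟩ := h4 y' (by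
      refine Finset.mem_filter.2 ⟨Fintype.mem_piFinset.2 fun i => Finset.mem_Ico.2 ?_, hy.congr hyy⟩
      by_cases hi : i ∈ K
      · simpa [y', hi] using hB
      · obtain ⟨s, hs, hsy⟩ := id hy
        have h6 := hSB y hy i hi
        have h7 := hS s hs i
        rw [hsy i hi] at h7
        simp [y', hi, h6, h7])
    exact ⟨T₁, T₂, e, h5.trans hyy.symm⟩
  have hTmem : T.sum ∈ cycleSums A S K L := ⟨h2, x, T, hx, h1, rfl, h3'⟩
  obtain ⟨R, hR, hRs⟩ := hc.exists_reverse_walk h1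
  have hR' : Walk A S K x R := hR.congr fun i hi => by simp [h2 i hi]
  obtain ⟨l, hl, hls⟩ := exists_list_cycleSums hB hS hSB (pow_le_cycleLen hB) hx hR'
    (fun i hi => by simp [hRs, h2 i hi])
  obtain ⟨l', h6, h7, h8, h9⟩ := exists_short_zero_sum (V := cycleSums A S K L) (v := T.sum)
    (fun b hb => cycleSums_abs_le hA hb)
    ⟨T.sum :: l, by simpa [hTmem] using hl, by simp, by simp [hls, hRs]⟩
  have hp := List.perm_cons_erase h7
  obtain ⟨T', h10, h11, h12, h13⟩ := exists_insert (L := L) h1 hvis (l'.erase T.sum)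
    fun v hv => h6 v (List.mem_of_mem_erase hv)
  refine ⟨T', h10, ?_, ?_, h13⟩
  · rw [h11, ← h8, hp.sum_eq, List.sum_cons]
  · have h14 : l'.length = (l'.erase T.sum).length + 1 := by simpa using hp.length_eq
    calc T'.length ≤ L + (l'.erase T.sum).length * L := h12.trans (by gcongr)
      _ = L * l'.length := by rw [h14]; ring
      _ ≤ _ := by gcongr; exact h9

/-- A bound for the depth below a segment of a closed walk with a prescribed displacement. -/
def slack (d a B : ℕ) : ℕ :=
  deviation d (a * cycleLen d B) + a * (cycleLen d B *
    (2 * deviation d (a * cycleLen d B) + 1) ^ d + cycleLen d B)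

/-- The displacement of a closed walk is also that of a closed walk that
stays close to the segment joining its ends. -/
theorem exists_closed_walk_near_segment {a B : ℕ} (hB : 0 < B)
    (hA : ∀ b ∈ A, ∀ i, |b i| ≤ (a : ℤ))
    (hS : ∀ s ∈ S, ∀ i, 0 ≤ s i) (hc : Connected A S)
    (hSB : ∀ y, InProj S K y → ∀ i ∉ K, y i < B) (hx : InProj S K x)
    (hw : Walk A S K x σ) (hσ : AgreeOff K σ.sum 0) :
    ∃ m, Walk A S K x m ∧ m.sum = σ.sum ∧
      Stay (fun y => ∀ i, min (x i) (x i + σ.sum i) - slack d a B ≤ y i) x m := by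
  classical
  obtain ⟨T, hT, hT0, hTl, hvis⟩ := exists_zero_tour hB hA hS hc hSB hx
  set L := cycleLen d B with hL
  set L₀ := L * (2 * deviation d (a * L) + 1) ^ d with hL₀
  obtain ⟨l₀, hl₀, hls₀⟩ := exists_list_cycleSums hB hS hSB (pow_le_cycleLen hB) hx hw hσ
  have hβ : ∀ b ∈ l₀, ∀ i, |b i| ≤ ((a * L : ℕ) : ℤ) := fun b hb =>
    cycleSums_abs_le hA (hl₀ b hb)
  obtain ⟨l, hp, hst⟩ := exists_perm_stay l₀ hβ (card_toFinset_le hβ)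
  have hl : ∀ v ∈ l, v ∈ cycleSums A S K L := fun v hv => hl₀ v (hp.mem_iff.1 hv)
  have hls : l.sum = σ.sum := hp.sum_eq.trans hls₀
  rw [hls₀] at hst
  have key : ∀ l : List (Fin d → ℤ), (∀ v ∈ l, v ∈ cycleSums A S K L) → ∀ (lo y : Fin d → ℤ),
      AgreeOff K x y → Stay (fun y => ∀ i, lo i + (a * (L₀ + L) : ℕ) ≤ y i) y l →
      ∃ m, Walk A S K y m ∧ m.sum = l.sum ∧ Stay (fun y => ∀ i, lo i ≤ y i) y m := by
    intro l
    induction l with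
    | nil =>
      intro _ lo y _ h
      refine ⟨[], trivial, rfl, fun i => ?_⟩
      have := h i
      have h0 : (0 : ℤ) ≤ (a * (L₀ + L) : ℕ) := by positivity
      linarith
    | cons v l ih =>
      intro hl lo y hxy h
      have hv := hl v (by simp)
      obtain ⟨m, h1, h2, h3⟩ := ih (fun w hw => hl w (by simp [hw])) lo (y + v)
        (fun i hi => by simp [← hxy i hi, hv.1 i hi]) h.2
      obtain ⟨T', h4, h5, h6, -⟩ := exists_insert hT hvis [v] (by simpa using hv)
      have h5' : T'.sum = v := by simp [h5, hT0]
      have h4' : Walk A S K y T' := h4.congr hxy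
      refine ⟨T' ++ m, walk_append.2 ⟨h4', by rwa [h5']⟩, by simp [h2, h5'],
        stay_append.2 ⟨?_, by rwa [h5']⟩⟩
      refine (stay_abs_sub_le (fun b hb => hA b (h4.mem b hb)) y).mono fun z hz i => ?_
      have h7 := (abs_le.1 (hz i)).1
      have h8 := h.1 i
      have h9 : (a : ℤ) * T'.length ≤ (a * (L₀ + L) : ℕ) := by
        have : T'.length ≤ L₀ + L := by
          refine h6.trans ?_
          simpa using hTl
        push_cast
        have : (T'.length : ℤ) ≤ L₀ + L := by exact_mod_cast this
        gcongr
      linarith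
  obtain ⟨m, h1, h2, h3⟩ := key l hl (fun i => min (x i) (x i + σ.sum i) - slack d a B) x
    (AgreeOff.refl x) (by
      have := hst.shift x
      rw [zero_add] at this
      refine this.mono fun y hy i => ?_
      have h1 := (hy i).1
      have h2 : (slack d a B : ℤ) = deviation d (a * L) + (a * (L₀ + L) : ℕ) := by
        simp only [slack, ← hL, ← hL₀]
        push_cast
        ring
      rw [h2]
      have h3 : min (x i) (x i + σ.sum i) = x i + min 0 (σ.sum i) := by
        rw [← min_add_add_left, add_zero]
      rw [h3]
      simp only [deviation, Pi.sub_apply] at h1 ⊢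
      linarith)
  exact ⟨m, h1, h2.trans hls, h3⟩

end VAS

namespace VAS

variable {d : ℕ} {A S : Set (Fin d → ℤ)} {K : Finset (Fin d)} {x y z : Fin d → ℤ}
  {σ τ : List (Fin d → ℤ)} {P Q : (Fin d → ℤ) → Prop}

open Classical in
/-- The coordinates that reach the value `n` in `S`. -/
noncomputable def highCoords {d : ℕ} (S : Set (Fin d → ℤ)) (n : ℕ) : Finset (Fin d) :=
  Finset.univ.filter fun i => ∃ s ∈ S, (n : ℤ) ≤ s i

theorem mem_highCoords {n : ℕ} {i : Fin d} : i ∈ highCoords S n ↔ ∃ s ∈ S, (n : ℤ) ≤ s i := by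
  simp [highCoords]

theorem highCoords_anti {m n : ℕ} (h : m ≤ n) : highCoords S n ⊆ highCoords S m := by
  intro i hi
  obtain ⟨s, hs, hn⟩ := mem_highCoords.1 hi
  exact mem_highCoords.2 ⟨s, hs, le_trans (by exact_mod_cast h) hn⟩

/-- As long as more than `s` coordinates reach the threshold `lam (s + 1)`, one can climb with a
short walk to a configuration where one more coordinate is large. -/
theorem exists_climb {a : ℕ} {lam : ℕ → ℕ} (hA : ∀ b ∈ A, ∀ i, |b i| ≤ (a : ℤ))
    (hS : ∀ s ∈ S, ∀ i, 0 ≤ s i) (hc : Connected A S) (hlam : Antitone lam)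
    (hpos : ∀ t, 0 < lam t) (hstep : ∀ t ≤ d, lam (t + 1) + a * lam (t + 1) ^ d ≤ lam t)
    (hx : x ∈ S) (t : ℕ) (htd : t ≤ d) (ht : ∀ s < t, s < (highCoords S (lam (s + 1))).card) :
    ∃ K : Finset (Fin d), K.card = t ∧ K ⊆ highCoords S (lam t) ∧ ∃ σ, Walk A S K x σ ∧
      Stay (fun y => ∀ i, 0 ≤ y i) x σ ∧ (∀ k ∈ K, (lam t : ℤ) ≤ (x + σ.sum) k) ∧
      σ.length ≤ t * lam 1 ^ d := by
  classical
  induction t with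
  | zero => exact ⟨∅, rfl, by simp, [], trivial, hS x hx, by simp, by simp⟩
  | succ t ih =>
    obtain ⟨K, hK, hKh, σ, h1, h2, h3, h4⟩ := ih (by omega) fun s hs => ht s (by omega)
    have hxP : InProj S K (x + σ.sum) := h1.inProj (InProj.of_mem hx)
    obtain ⟨i, hi, hiK⟩ := Finset.exists_mem_notMem_of_card_lt_card (hK ▸ ht t (by omega))
    obtain ⟨s, hs, hsi⟩ := mem_highCoords.1 hi
    rw [hK] at hsi
    obtain ⟨τ, h5, ⟨j, hjK, hj⟩, h6⟩ := exists_short_walk (hpos (t + 1)) hS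
      (P := fun y => ∃ j ∉ K, (lam (t + 1) : ℤ) ≤ y j)
      (fun y z hyz ⟨j, hj, h⟩ => ⟨j, hj, hyz j hj ▸ h⟩)
      (fun y _ hy i hi => by
        by_contra! h
        exact hy ⟨i, hi, h⟩) hxP (by
        obtain ⟨τ, hτ, hτs⟩ := hc.exists_walk hxP (InProj.of_mem hs)
        exact ⟨τ, hτ, i, hiK, (hτs i hiK).symm ▸ hsi⟩)
    have hmove := stay_abs_sub_le (fun b hb => hA b (h5.mem b hb)) (x + σ.sum)
    have hle : (a : ℤ) * τ.length + lam (t + 1) ≤ lam t := by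
      have h7 := hstep t (by omega)
      have h8 : a * τ.length ≤ a * lam (t + 1) ^ d := by gcongr
      exact_mod_cast (by omega : a * τ.length + lam (t + 1) ≤ lam t)
    have hlow : Stay (fun y => ∀ i, (i ∉ K → 0 ≤ y i) ∧ (i ∈ K → (lam (t + 1) : ℤ) ≤ y i))
        (x + σ.sum) τ := by
      refine (hmove.and (h5.stay_inProj hxP)).mono fun y ⟨hy, s, hs, hsy⟩ i =>
        ⟨fun hi => hsy i hi ▸ hS s hs i, fun hi => ?_⟩
      have h7 := (abs_le.1 (hy i)).1
      have h8 := h3 i hi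
      linarith
    refine ⟨insert j K, by rw [Finset.card_insert_of_notMem hjK, hK], ?_, σ ++ τ,
      walk_append.2 ⟨h1.mono (Finset.subset_insert j K), h5.mono (Finset.subset_insert j K)⟩,
      stay_append.2 ⟨h2, hlow.mono fun y hy i => ?_⟩, ?_, ?_⟩
    · refine Finset.insert_subset ?_ (hKh.trans (highCoords_anti (hlam (Nat.le_succ t))))
      obtain ⟨s, hs, hsj⟩ := h5.inProj hxP
      exact mem_highCoords.2 ⟨s, hs, (hsj j hjK).symm ▸ hj⟩
    · by_cases hi : i ∈ K
      · exact le_trans (by positivity) ((hy i).2 hi)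
      · exact (hy i).1 hi
    · intro k hk
      rw [List.sum_append, ← add_assoc]
      rcases Finset.mem_insert.1 hk with rfl | hk
      · exact hj
      · exact (hlow.last k).2 hk
    · rw [List.length_append, add_mul, one_mul]
      exact add_le_add h4 (h6.trans (Nat.pow_le_pow_left (hlam (by omega)) d))

/-- Every step between configurations of `S` starts a cycle that does not go far below its
origin. -/
theorem exists_cycle_of_bounded_drop {a : ℕ} {lam : ℕ → ℕ}
    (hA : ∀ b ∈ A, ∀ i, |b i| ≤ (a : ℤ)) (hS : ∀ s ∈ S, ∀ i, 0 ≤ s i) (hc : Connected A S)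
    (hlam : Antitone lam) (hpos : ∀ t, 0 < lam t)
    (hstep : ∀ t ≤ d, lam (t + 1) + a * lam (t + 1) ^ d ≤ lam t)
    (hgap : ∀ t ≤ d, slack d a (lam (t + 1)) + a * lam (t + 1) ^ d ≤ lam t)
    {b : Fin d → ℤ} (hb : b ∈ A) (hx : x ∈ S) (hxb : x + b ∈ S) :
    ∃ α : List (Fin d → ℤ), (∀ e ∈ α, e ∈ A) ∧ b + α.sum = 0 ∧
      Stay (fun y => ∀ i, 0 ≤ y i ∧ x i - (a * (1 + (d + 1) * lam 1 ^ d) + lam 0 : ℕ) ≤ y i)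
        x (b :: α) := by
  classical
  have hex : ∃ t, (highCoords S (lam (t + 1))).card ≤ t :=
    ⟨d, (Finset.card_le_univ _).trans (by simp)⟩
  obtain ⟨t, ht, htmin⟩ : ∃ t, (highCoords S (lam (t + 1))).card ≤ t ∧
      ∀ s < t, s < (highCoords S (lam (s + 1))).card :=
    ⟨Nat.find hex, Nat.find_spec hex, fun s hs => not_le.1 (Nat.find_min hex hs)⟩
  have htd : t ≤ d := by
    by_contra! h
    exact absurd (htmin d h) (not_lt.2 ((Finset.card_le_univ _).trans (by simp)))
  have huniq : ∀ K : Finset (Fin d), K.card = t → K ⊆ highCoords S (lam t) →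
      K = highCoords S (lam (t + 1)) := fun K hK hKh =>
    Finset.eq_of_subset_of_card_le (hKh.trans (highCoords_anti (hlam (Nat.le_succ t))))
      (hK ▸ ht)
  have hA' : ∀ b ∈ Neg.neg ⁻¹' A, ∀ i, |b i| ≤ (a : ℤ) := fun b hb i => by
    simpa using hA (-b) hb i
  obtain ⟨K, hK, hKh, u, hu, hu0, huK, hul⟩ :=
    exists_climb hA hS hc hlam hpos hstep hxb t htd htmin
  obtain ⟨K', hK', hKh', v', hv', hv0', hvK, hvl⟩ :=
    exists_climb hA' hS hc.neg hlam hpos hstep hx t htd htmin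
  obtain rfl : K' = K := (huniq K' hK' hKh').trans (huniq K hK hKh).symm
  have hKeq := huniq K' hK' hKh'
  generalize K' = K at *
  set B := lam (t + 1) with hB
  have hSB : ∀ y, InProj S K y → ∀ i ∉ K, y i < B := by
    intro y ⟨s, hs, hsy⟩ i hi
    by_contra! h
    rw [← hsy i hi] at h
    exact hi (hKeq ▸ mem_highCoords.2 ⟨s, hs, h⟩)
  set f := x + b + u.sum with hf
  set g := x + v'.sum with hg
  have hfP : InProj S K f := hu.inProj (InProj.of_mem hxb)
  have hvw : Walk A S K g (undo v') := walk_undo hv'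
  have hgP : InProj S K g := hv'.inProj (InProj.of_mem hx)
  obtain ⟨q, hq, hqg, hql⟩ : ∃ q, Walk A S K f q ∧ AgreeOff K (f + q.sum) g ∧
      q.length ≤ B ^ d :=
    exists_short_walk (P := fun z => AgreeOff K z g) (hpos (t + 1)) hS
      (fun z w hzw hz => hzw.symm.trans hz) (fun z hz _ => hSB z hz) hfP (hc.exists_walk hfP hgP)
  have hloop : Walk A S K f (q ++ (undo v' ++ ([b] ++ u))) := by
    refine walk_append.2 ⟨hq, walk_append.2 ⟨hvw.congr hqg.symm, ?_⟩⟩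
    refine Walk.congr (x := x) (fun i hi => ?_)
      (walk_append.2 ⟨⟨⟨hb, x, hx, hxb, AgreeOff.refl x⟩, trivial⟩, by simpa using hu⟩)
    have := hqg i hi
    simp [undo_sum, hg] at this ⊢
    linarith
  obtain ⟨r, hr, hrs⟩ := hc.exists_reverse_walk hloop
  have hloop0 : (q ++ (undo v' ++ ([b] ++ u))).sum = f + q.sum - g := by
    simp [undo_sum, hf, hg]
    abel
  have hclosed : AgreeOff K (f + q.sum - g) 0 := fun i hi => by simp [← hqg i hi]
  rw [hloop0] at hr hrs
  obtain ⟨m, hm, hms, hmst⟩ := exists_closed_walk_near_segment (hpos (t + 1)) hA hS hc hSB hfP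
    (hr.congr (y := f) fun i hi => by
      have := hclosed i hi
      simp at this ⊢
      linarith)
    (fun i hi => by
      have := hclosed i hi
      rw [hrs]
      simp at this ⊢
      linarith)
  rw [hrs] at hms hmst
  rw [← hB] at hmst
  have hfm : f + m.sum + q.sum = g := by
    rw [hms]
    abel
  have hmK : AgreeOff K m.sum 0 := fun i hi => by
    have := hclosed i hi
    rw [hms]
    simp at this ⊢
    linarith
  have hqw : Walk A S K (f + m.sum) q := hq.congr fun i hi => by simp [hmK i hi]
  have hgap' : (slack d a B : ℤ) + a * B ^ d ≤ lam t := by exact_mod_cast hgap t htd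
  have hlam1 : B ≤ lam 1 := hlam (by omega)
  have hlam0 : (lam t : ℤ) ≤ lam 0 := by exact_mod_cast hlam (Nat.zero_le t)
  have hslack0 : (0 : ℤ) ≤ slack d a B := by positivity
  have hBd : (a : ℤ) * B ^ d ≤ a * lam 1 ^ d := by gcongr
  have hbound : ((a * (1 + (d + 1) * lam 1 ^ d) + lam 0 : ℕ) : ℤ) =
      a + a * (d * lam 1 ^ d) + a * lam 1 ^ d + lam 0 := by
    push_cast
    ring
  have hclimb : ∀ w : List (Fin d → ℤ), w.length ≤ t * lam 1 ^ d →
      (a : ℤ) * w.length ≤ a * (d * lam 1 ^ d) := by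
    intro w hw
    have : w.length ≤ d * lam 1 ^ d := hw.trans (by gcongr)
    gcongr
    exact_mod_cast this
  have hulen := hclimb u hul
  have hvlen := hclimb v' hvl
  have hqlen : (a : ℤ) * q.length ≤ a * B ^ d := by
    gcongr
    exact_mod_cast hql
  have ha0 : (0 : ℤ) ≤ a := by positivity
  have hd0 : (0 : ℤ) ≤ a * (d * lam 1 ^ d) := by positivity
  have h10 : (0 : ℤ) ≤ a * lam 1 ^ d := by positivity
  have hB0 : (0 : ℤ) ≤ a * B ^ d := by positivity
  have hbi : ∀ i, -(a : ℤ) ≤ b i := fun i => (abs_le.1 (hA b hb i)).1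
  have hust := hu0.and (stay_abs_sub_le (fun e he => hA e (hu.mem e he)) (x + b))
  have hvst := hv0'.and (stay_abs_sub_le (fun e he => hA' e (hv'.mem e he)) x)
  have hfx : ∀ i, x i - a - a * (d * lam 1 ^ d) ≤ f i := fun i => by
    have h1 := (abs_le.1 (hust.last.2 i)).1
    have h2 := hbi i
    simp only [Pi.add_apply, hf] at h1 ⊢
    linarith
  have hgx : ∀ i, x i - a * (d * lam 1 ^ d) ≤ g i := fun i => by
    have h1 := (abs_le.1 (hvst.last.2 i)).1
    simp only [Pi.add_apply, hg] at h1 ⊢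
    linarith
  have hqsum : ∀ i, |q.sum i| ≤ (a : ℤ) * q.length :=
    fun i => abs_sum_le (fun e he => hA e (hq.mem e he)) i
  have hfK : ∀ k ∈ K, (lam t : ℤ) ≤ f k := huK
  have hgK : ∀ k ∈ K, (lam t : ℤ) ≤ g k := hvK
  refine ⟨u ++ m ++ q ++ undo v', ?_, ?_, ?_, ?_⟩
  · intro e he
    simp only [List.mem_append] at he
    rcases he with ((he | he) | he) | he
    · exact hu.mem e he
    · exact hm.mem e he
    · exact hq.mem e he
    · exact hvw.mem e he
  · simp only [List.sum_append, undo_sum]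
    have : b + (u.sum + m.sum + q.sum + -v'.sum) = f + m.sum + q.sum - g := by
      simp only [hf, hg]
      abel
    rw [this, hfm, sub_self]
  · intro i
    refine ⟨hS x hx i, ?_⟩
    rw [hbound]
    linarith
  · have e1 : x + b + (u ++ m ++ q).sum = g := by
      simp only [List.sum_append]
      rw [← hfm, hf]
      abel
    have e2 : x + b + (u ++ m).sum = f + m.sum := by
      simp only [List.sum_append, hf]
      abel
    rw [stay_append, stay_append, stay_append, e1, e2, ← hf]
    refine ⟨⟨⟨hust.mono fun y hy i => ⟨hy.1 i, ?_⟩, ?_⟩, ?_⟩, ?_⟩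
    · have h1 := (abs_le.1 (hy.2 i)).1
      have h2 := hbi i
      rw [hbound]
      simp only [Pi.add_apply] at h1
      linarith
    · refine (hmst.and (hm.stay_inProj hfP)).mono fun y ⟨hy, s, hs, hsy⟩ i => ?_
      have h1 := hy i
      have h2 : f i + (-(f + q.sum - g)) i = g i - q.sum i := by
        simp only [Pi.neg_apply, Pi.sub_apply, Pi.add_apply]
        ring
      rw [h2] at h1
      have h3 := (abs_le.1 (hqsum i)).2
      constructor
      · by_cases hi : i ∈ K
        · have h4 := hfK i hi
          have h5 := hgK i hi
          have h6 : (lam t : ℤ) - a * B ^ d ≤ min (f i) (g i - q.sum i) :=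
            le_min (by linarith) (by linarith)
          linarith
        · exact hsy i hi ▸ hS s hs i
      · have h4 := hfx i
        have h5 := hgx i
        have h6 : x i - a - a * (d * lam 1 ^ d) - a * B ^ d ≤ min (f i) (g i - q.sum i) :=
          le_min (by linarith) (by linarith)
        rw [hbound]
        linarith
    · have hrev := stay_abs_sub_le (σ := undo q) (a := a)
        (fun e he i => by
          simp only [undo, List.mem_reverse, List.mem_map] at he
          obtain ⟨e', he', rfl⟩ := he
          simpa using hA e' (hq.mem e' he') i) g
      have hrev' := stay_undo hrev
      have e3 : g + (undo q).sum = f + m.sum := by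
        rw [undo_sum, ← hfm]
        abel
      have e4 : undo (undo q) = q := by
        simp [undo, List.map_reverse]
      rw [e3, e4, undo_length] at hrev'
      refine (hrev'.and (hqw.stay_inProj (hm.inProj hfP))).mono fun y ⟨hy, s, hs, hsy⟩ i => ?_
      have h1 := (abs_le.1 (hy i)).1
      constructor
      · by_cases hi : i ∈ K
        · have := hgK i hi
          linarith
        · exact hsy i hi ▸ hS s hs i
      · have := hgx i
        rw [hbound]
        linarith
    · refine (stay_undo hvst).mono fun y hy i => ⟨hy.1 i, ?_⟩
      have h1 := (abs_le.1 (hy.2 i)).1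
      rw [hbound]
      linarith

end VAS

namespace VAS

theorem slack_add_le_pow {d a B : ℕ} (hd : 0 < d) (ha : 0 < a) (hB : 5 * a ≤ B) :
    slack d a B + 2 * a * B ^ d ≤ B ^ (15 * d ^ (d + 2)) := by
  have hB0 : 0 < B := by omega
  set β := a * cycleLen d B with hβ
  set γ := 2 * β + 1 with hγ
  have hβ' : β = 2 * a * B ^ (2 * d) := by
    rw [hβ, cycleLen, ← pow_mul, mul_comm d 2]
    ring
  have hpow : 1 ≤ B ^ (2 * d) := Nat.one_le_pow _ _ hB0
  have haB : a ≤ a * B ^ (2 * d) := Nat.le_mul_of_pos_right a hpow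
  have h1 : γ ≤ B ^ (2 * d + 1) := by
    calc γ ≤ 5 * a * B ^ (2 * d) := by rw [hγ, hβ']; nlinarith
      _ ≤ B * B ^ (2 * d) := by gcongr
      _ = _ := by ring
  have h3 : 3 ≤ γ := by rw [hγ, hβ']; nlinarith
  have hdev : deviation d β ≤ γ ^ (d + 1) := by
    calc deviation d β = γ ^ d * (2 * β) := by rw [deviation]; ring
      _ ≤ γ ^ d * γ := by gcongr; omega
      _ = _ := by ring
  have h4 : 2 * deviation d β + 1 ≤ γ ^ (d + 2) := by
    have : 1 ≤ γ ^ (d + 1) := Nat.one_le_pow _ _ (by omega)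
    calc 2 * deviation d β + 1 ≤ 3 * γ ^ (d + 1) := by omega
      _ ≤ γ * γ ^ (d + 1) := by gcongr
      _ = _ := by ring
  have h5 : (2 * deviation d β + 1) ^ d ≤ γ ^ ((d + 2) * d) := by
    rw [pow_mul]
    gcongr
  have h6 : slack d a B = deviation d β + (β * (2 * deviation d β + 1) ^ d + β) := by
    rw [slack, ← hβ, mul_add, ← mul_assoc]
  have h7 : 1 ≤ γ ^ ((d + 2) * d) := Nat.one_le_pow _ _ (by omega)
  have h8 : slack d a B ≤ 2 * γ ^ ((d + 2) * d + 1) := by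
    have h9 : γ ^ (d + 1) ≤ γ ^ ((d + 2) * d + 1) :=
      Nat.pow_le_pow_right (by omega) (by nlinarith)
    have h10 : β * (2 * deviation d β + 1) ^ d ≤ β * γ ^ ((d + 2) * d) := by gcongr
    have h11 : β * γ ^ ((d + 2) * d) + β ≤ γ ^ ((d + 2) * d + 1) := by
      rw [pow_succ]
      nlinarith
    omega
  have h9 : 2 * a * B ^ d ≤ γ ^ ((d + 2) * d + 1) := by
    have : B ^ d ≤ B ^ (2 * d) := Nat.pow_le_pow_right hB0 (by omega)
    calc 2 * a * B ^ d ≤ 2 * a * B ^ (2 * d) := by gcongr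
      _ ≤ γ := by omega
      _ ≤ _ := Nat.le_self_pow (by omega) γ
  calc slack d a B + 2 * a * B ^ d ≤ 3 * γ ^ ((d + 2) * d + 1) := by omega
    _ ≤ γ * γ ^ ((d + 2) * d + 1) := by gcongr
    _ = γ ^ ((d + 2) * d + 2) := by ring
    _ ≤ (B ^ (2 * d + 1)) ^ ((d + 2) * d + 2) := by gcongr
    _ = B ^ ((2 * d + 1) * ((d + 2) * d + 2)) := by rw [pow_mul]
    _ ≤ _ := by
      refine Nat.pow_le_pow_right hB0 ?_
      have h10 : d ^ 3 ≤ d ^ (d + 2) := Nat.pow_le_pow_right hd (by omega)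
      have h11 : (2 * d + 1) * ((d + 2) * d + 2) ≤ (3 * d) * (5 * d ^ 2) :=
        Nat.mul_le_mul (by omega) (by nlinarith)
      have h12 : (3 * d) * (5 * d ^ 2) = 15 * d ^ 3 := by ring
      omega

/-- The thresholds for the coordinates of a configuration. -/
def threshold (d a t : ℕ) : ℕ := (102 * d ^ 2 * a ^ 2) ^ ((15 * d ^ (d + 2)) ^ (d + 1 - t))

theorem le_threshold {d a : ℕ} (hd : 0 < d) (t : ℕ) :
    102 * d ^ 2 * a ^ 2 ≤ threshold d a t :=
  Nat.le_self_pow (by positivity) _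

theorem threshold_pos {d a : ℕ} (hd : 0 < d) (ha : 0 < a) (t : ℕ) : 0 < threshold d a t :=
  lt_of_lt_of_le (by positivity) (le_threshold hd t)

theorem threshold_antitone {d a : ℕ} (hd : 0 < d) (ha : 0 < a) : Antitone (threshold d a) := by
  intro s t hst
  refine Nat.pow_le_pow_right (by positivity) (Nat.pow_le_pow_right (by positivity) ?_)
  omega

theorem threshold_eq {d a t : ℕ} (ht : t ≤ d) :
    threshold d a t = threshold d a (t + 1) ^ (15 * d ^ (d + 2)) := by
  rw [threshold, threshold, ← pow_mul, ← pow_succ]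
  congr 2
  omega

theorem slack_threshold_le {d a : ℕ} (hd : 0 < d) (ha : 0 < a) {t : ℕ} (ht : t ≤ d) :
    slack d a (threshold d a (t + 1)) + 2 * a * threshold d a (t + 1) ^ d ≤ threshold d a t := by
  rw [threshold_eq ht]
  refine slack_add_le_pow hd ha (le_trans ?_ (le_threshold hd (t + 1)))
  have h1 : 1 ≤ d ^ 2 := Nat.one_le_pow _ _ hd
  have h2 : a ≤ a ^ 2 := Nat.le_self_pow (by norm_num) a
  nlinarith [Nat.mul_le_mul h1 h2]

theorem drop_le {d a : ℕ} (hd : 0 < d) (ha : 0 < a) :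
    a * (1 + (d + 1) * threshold d a 1 ^ d) + threshold d a 0 ≤
      (102 * d ^ 2 * a ^ 2) ^ ((15 * d ^ (d + 2)) ^ (d + 2)) := by
  set X := 102 * d ^ 2 * a ^ 2 with hX
  set E := 15 * d ^ (d + 2) with hE
  have h1 : 1 ≤ threshold d a 1 ^ d := Nat.one_le_pow _ _ (threshold_pos hd ha 1)
  have hdd : d ≤ d ^ 2 := Nat.le_self_pow (by norm_num) d
  have haa : a ≤ a ^ 2 := Nat.le_self_pow (by norm_num) a
  have hX1 : a * (d + 2) ≤ X := by
    have := Nat.mul_le_mul hdd haa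
    nlinarith
  have hX2 : 2 ≤ X := by nlinarith
  have hdE : d + 1 ≤ E := by
    have : d ≤ d ^ (d + 2) := Nat.le_self_pow (by omega) d
    omega
  have h2 : a * (1 + (d + 1) * threshold d a 1 ^ d) ≤ threshold d a 0 := by
    calc a * (1 + (d + 1) * threshold d a 1 ^ d)
        ≤ a * (d + 2) * threshold d a 1 ^ d := by nlinarith
      _ ≤ threshold d a 1 * threshold d a 1 ^ d := by
          gcongr
          exact hX1.trans (le_threshold hd 1)
      _ = threshold d a 1 ^ (d + 1) := by ring
      _ ≤ threshold d a 1 ^ E := Nat.pow_le_pow_right (threshold_pos hd ha 1) hdE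
      _ = _ := (threshold_eq (Nat.zero_le d)).symm
  calc _ ≤ 2 * threshold d a 0 := by omega
    _ ≤ X * X ^ (E ^ (d + 1)) := Nat.mul_le_mul hX2 le_rfl
    _ = X ^ (E ^ (d + 1) + 1) := by ring
    _ ≤ _ := by
      refine Nat.pow_le_pow_right (by omega) ?_
      have : 1 ≤ E ^ (d + 1) := Nat.one_le_pow _ _ (by omega)
      rw [pow_succ E (d + 1)]
      nlinarith

variable {d : ℕ} {A : Finset (Fin d → ℤ)} {x y z c : Fin d → ℕ} {σ τ : List (Fin d → ℤ)}

theorem Run.append (h : Run A x σ y) (h' : Run A y τ z) : Run A x (σ ++ τ) z := by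
  induction h with
  | nil x => exact h'
  | cons ha hstep _ ih => exact Run.cons ha hstep (ih h')

theorem Run.add_right (v : Fin d → ℕ) (h : Run A x σ y) : Run A (x + v) σ (y + v) := by
  induction h with
  | nil x => exact Run.nil _
  | cons ha hstep _ ih =>
    refine Run.cons ha ?_ ih
    ext i
    have := congrFun hstep i
    simp [toIntVec] at this ⊢
    linarith

theorem exists_run_of_stay (hσ : ∀ b ∈ σ, b ∈ A)
    (h : Stay (fun y => ∀ i, 0 ≤ y i) (toIntVec x) σ) :
    ∃ y, toIntVec y = toIntVec x + σ.sum ∧ Run A x σ y := by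
  induction σ generalizing x with
  | nil => exact ⟨x, by simp, Run.nil x⟩
  | cons b σ ih =>
    let x' : Fin d → ℕ := fun i => (toIntVec x i + b i).toNat
    have hx' : toIntVec x' = toIntVec x + b := by
      ext i
      exact Int.toNat_of_nonneg (h.2.head i)
    obtain ⟨y, hy, hr⟩ := ih (x := x') (fun e he => hσ e (by simp [he])) (by rw [hx']; exact h.2)
    exact ⟨y, by rw [hy, hx', List.sum_cons, add_assoc], Run.cons (hσ b (by simp)) hx' hr⟩

theorem mem_reversibilityDomain_of_stay {a : Fin d → ℤ} (hσ : ∀ b ∈ a :: σ, b ∈ A)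
    (hsum : a + σ.sum = 0) (h : Stay (fun y => ∀ i, 0 ≤ y i) (toIntVec x) (a :: σ)) :
    x ∈ reversibilityDomain A a := by
  have h1 : Stay (fun y => ∀ i, 0 ≤ y i) (toIntVec x) [a] := ⟨h.head, h.2.head⟩
  obtain ⟨x', hx', hr⟩ := exists_run_of_stay (A := A)
    (by simpa using hσ a (by simp)) h1
  have hx'' : toIntVec x' = toIntVec x + a := by simpa using hx'
  obtain ⟨y, hy, hr'⟩ := exists_run_of_stay (A := A) (x := x') (σ := σ)
    (fun b hb => hσ b (by simp [hb])) (by rw [hx'']; exact h.2)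
  have : y = x := by
    rw [hx'', add_assoc, hsum, add_zero] at hy
    ext i
    have := congrFun hy i
    simpa [toIntVec] using this
  exact ⟨x', hx'', hr, σ, this ▸ hr'⟩

/-- The configurations that `c` can reach and that can reach `c`. -/
def component {d : ℕ} (A : Finset (Fin d → ℤ)) (c : Fin d → ℕ) : Set (Fin d → ℤ) :=
  {s | ∃ x, toIntVec x = s ∧ (∃ σ, Run A c σ x) ∧ ∃ σ, Run A x σ c}

theorem Run.walk_component (h : Run A x σ y) (hx : ∃ τ, Run A c τ x) (hy : ∃ τ, Run A y τ c) :
    Walk (A : Set (Fin d → ℤ)) (component A c) ∅ (toIntVec x) σ ∧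
      toIntVec x + σ.sum = toIntVec y := by
  induction h with
  | nil x => exact ⟨trivial, by simp⟩
  | @cons x y z a σ ha hstep hrun ih =>
    obtain ⟨τ, hτ⟩ := hx
    obtain ⟨ρ, hρ⟩ := hy
    have hxy : Run A x [a] y := Run.cons ha hstep (Run.nil y)
    obtain ⟨h1, h2⟩ := ih ⟨τ ++ [a], hτ.append hxy⟩ ⟨ρ, hρ⟩
    have hyc := hrun.append hρ
    rw [hstep] at h1 h2
    exact ⟨⟨⟨ha, _, ⟨x, rfl, ⟨τ, hτ⟩, _, hxy.append hyc⟩,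
      ⟨y, hstep, ⟨_, hτ.append hxy⟩, _, hyc⟩, AgreeOff.refl _⟩, h1⟩,
      by rw [List.sum_cons, ← add_assoc, h2]⟩

theorem connected_component (A : Finset (Fin d → ℤ)) (c : Fin d → ℕ) :
    Connected (A : Set (Fin d → ℤ)) (component A c) := by
  rintro _ ⟨x, rfl, hcx, σ, hxc⟩ _ ⟨y, rfl, ⟨τ, hcy⟩, hyc⟩
  exact ⟨σ ++ τ, (hxc.append hcy).walk_component hcx hyc⟩

theorem abs_le_setNorm {b : Fin d → ℤ} (hb : b ∈ A) (i : Fin d) : |b i| ≤ (setNorm A : ℤ) := by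
  have h1 : (b i).natAbs ≤ vecNorm b :=
    Finset.le_sup (f := fun i => (b i).natAbs) (Finset.mem_univ i)
  have h2 : vecNorm b ≤ setNorm A := Finset.le_sup hb
  rw [Int.abs_eq_natAbs]
  exact_mod_cast h1.trans h2

theorem isUpperSet_reversibilityDomain (A : Finset (Fin d → ℤ)) (a : Fin d → ℤ) :
    IsUpperSet (reversibilityDomain A a) := by
  rintro x y hxy ⟨x', hx', hr, α, hα⟩
  obtain ⟨v, rfl⟩ := exists_add_of_le hxy
  refine ⟨x' + v, ?_, hr.add_right v, α, hα.add_right v⟩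
  ext i
  have := congrFun hx' i
  simp [toIntVec] at this ⊢
  linarith

/-- Lowering the large coordinates of a configuration of the reversibility domain. -/
theorem truncate_mem_reversibilityDomain {a : Fin d → ℤ} (ha : a ∈ A)
    (hc : c ∈ reversibilityDomain A a) (hd : 0 < d) (hA : 0 < setNorm A) :
    (fun i => min (c i) ((102 * d ^ 2 * (setNorm A) ^ 2) ^ ((15 * d ^ (d + 2)) ^ (d + 2)))) ∈
      reversibilityDomain A a := by
  obtain ⟨c', hc', hr, ρ, hρ⟩ := hc
  have hcS : toIntVec c ∈ component A c := ⟨c, rfl, ⟨[], Run.nil c⟩, [], Run.nil c⟩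
  have hcS' : toIntVec c + a ∈ component A c := ⟨c', hc', ⟨[a], hr⟩, ρ, hρ⟩
  have hgap := fun t (ht : t ≤ d) => slack_threshold_le hd hA ht
  have hlow : ∀ t, threshold d (setNorm A) t ≤
      setNorm A * threshold d (setNorm A) t ^ d := fun t =>
    (Nat.le_self_pow hd.ne' _).trans (Nat.le_mul_of_pos_left _ hA)
  obtain ⟨α, hα, hsum, hst⟩ := exists_cycle_of_bounded_drop (lam := threshold d (setNorm A))
    (fun b hb => abs_le_setNorm hb)
    (by
      rintro _ ⟨x, rfl, -⟩ i
      simp [toIntVec]) (connected_component A c)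
    (threshold_antitone hd hA) (threshold_pos hd hA)
    (fun t ht => by
      have h1 := hgap t ht
      have h2 := hlow (t + 1)
      rw [mul_assoc] at h1
      omega)
    (fun t ht => by
      have h1 := hgap t ht
      rw [mul_assoc] at h1
      omega) (show a ∈ (A : Set (Fin d → ℤ)) from ha) hcS hcS'
  have hdrop := drop_le hd hA
  set M := (102 * d ^ 2 * (setNorm A) ^ 2) ^ ((15 * d ^ (d + 2)) ^ (d + 2))
  refine mem_reversibilityDomain_of_stay (σ := α) (by simpa [ha] using hα) hsum ?_
  have := hst.shift (toIntVec (fun i => min (c i) M) - toIntVec c)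
  rw [add_sub_cancel] at this
  refine this.mono fun y hy i => ?_
  obtain ⟨h1, h2⟩ := hy i
  simp only [Pi.sub_apply, toIntVec] at h1 h2
  have hdrop' : ((setNorm A * (1 + (d + 1) * threshold d (setNorm A) 1 ^ d) +
    threshold d (setNorm A) 0 : ℕ) : ℤ) ≤ M := by exact_mod_cast hdrop
  rcases le_total (c i) M with h | h
  · rw [min_eq_left h] at h1
    linarith
  · rw [min_eq_right h] at h2
    linarith

theorem zero_mem_reversibilityDomain {a : Fin d → ℤ} (ha : a ∈ A) (hA : setNorm A = 0) :
    (0 : Fin d → ℕ) ∈ reversibilityDomain A a := by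
  have h0 : a = 0 := by
    ext i
    have := abs_le_setNorm ha i
    rw [hA] at this
    simpa using this
  have h1 : toIntVec (0 : Fin d → ℕ) = toIntVec 0 + a := by simp [h0]
  exact ⟨0, h1, Run.cons ha h1 (Run.nil _), [], Run.nil _⟩

end VAS

theorem mainTheorem4 (d : ℕ) (A : Finset (Fin d → ℤ)) (a : Fin d → ℤ) (ha : a ∈ A) :
    IsUpperSet (VAS.reversibilityDomain A a) ∧
      ∀ c : Fin d → ℕ, Minimal (fun x => x ∈ VAS.reversibilityDomain A a) c →
        VAS.vecNorm (VAS.toIntVec c) ≤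
          (102 * d ^ 2 * (VAS.setNorm A) ^ 2) ^ ((15 * d ^ (d + 2)) ^ (d + 2)) := by
  refine ⟨VAS.isUpperSet_reversibilityDomain A a, fun c hc => Finset.sup_le fun i _ => ?_⟩
  have hd : 0 < d := i.pos
  rcases Nat.eq_zero_or_pos (VAS.setNorm A) with hA | hA
  · have h := hc.2 (VAS.zero_mem_reversibilityDomain ha hA) (fun i => Nat.zero_le _) i
    have : c i = 0 := Nat.le_zero.1 h
    simp [VAS.toIntVec, this]
  · have h := hc.2 (VAS.truncate_mem_reversibilityDomain ha hc.1 hd hA)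
      (fun i => min_le_left _ _) i
    simpa [VAS.toIntVec] using h.trans (min_le_right _ _)
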